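/- Say that an entire function $f$ belongs to the Laguerre–Pólya class if $$f(z)=C z^m e^{-\alpha z^2+\beta z}\prod_{k}\Bigl(1-\frac{z}{x_k}\Bigr)e^{z/x_k},$$ where $C,\alpha,\beta,x_k\in\mathbb R$, $\alpha\ge 0$, $x_k\neq 0$, $m$ is a nonnegative integer, $\sum_k x_k^{-2}<\infty$, and the product is infinite, finite or empty. For $a>1$ let $g_a(z)=\sum_{j=0}^\infty z^j a^{-j^2}$ be the partial theta function, and let $$q_\infty=\inf\{a^2 : a>1,\ g_a \text{ belongs to the Laguerre–Pólya class}\}$$ be the Katkova–Lobova–Vishnyakova constant (numerically $q_\infty\approx 3.2336$; this value is mentioned only to identify the constant and is not part of the assertion). **Theorem.** Let $f(z)=\sum_{k=0}^\infty a_k z^k$ be an entire function with $a_k>0$ for all $k\ge 0$. Suppose that the second quotients $q_n(f)=\dfrac{a_{n-1}^2}{a_{n-2}a_n}$, $n\ge 2$, are nondecreasing in $n$, that is, $q_2(f)\le q_3(f)\le q_4(f)\le\cdots$, and that $\lim_{n\to\infty}q_n(f)=c<q_\infty$. Then $f$ does not belong to the Laguerre–Pólya class. -/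

import Mathlib

open Filter Topology

/-- The second quotients `q_n = a_{n-1}^2 / (a_{n-2} a_n)` of a coefficient sequence.
They are meant for `n ≥ 2` only. -/
noncomputable def secondQuotient (a : ℕ → ℝ) (n : ℕ) : ℝ :=
  a (n - 1) ^ 2 / (a (n - 2) * a n)

/-- The Laguerre–Pólya class: functions of the form
`C z^n exp (-α z^2 + β z) ∏ k, (1 - z / x k) exp (z / x k)` with real `C, α, β, x k`,
`α ≥ 0`, `x k ≠ 0` and `∑ k, (x k)⁻² < ∞`. The zeros are indexed by a set `S` of natural numbers,
so that the product may be infinite, finite or empty. -/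
def LaguerrePolya (f : ℂ → ℂ) : Prop :=
  ∃ (C α β : ℝ) (n : ℕ) (S : Set ℕ) (x : S → ℝ) (P : ℂ → ℂ),
    0 ≤ α ∧ (∀ k, x k ≠ 0) ∧ Summable (fun k => 1 / x k ^ 2) ∧
    (∀ z : ℂ, HasProd (fun k => (1 - z / (x k : ℂ)) * Complex.exp (z / (x k : ℂ))) (P z)) ∧
    ∀ z : ℂ, f z = (C : ℂ) * z ^ n * Complex.exp (-(α : ℂ) * z ^ 2 + (β : ℂ) * z) * P z

/-- The partial theta function `g_a(z) = ∑ j, z^j a^(-j^2)`; the series converges everywhere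
when `a > 1`. -/
noncomputable def partialTheta (a : ℝ) (z : ℂ) : ℂ :=
  ∑' j : ℕ, z ^ j / (a : ℂ) ^ (j ^ 2)

/-- The constant `q_∞`: the threshold (infimum) of the values `a^2`, `a > 1`, for which the partial
theta function `g_a` belongs to the Laguerre–Pólya class. -/
noncomputable def qInfty : ℝ :=
  sInf {q : ℝ | ∃ a : ℝ, 1 < a ∧ q = a ^ 2 ∧ LaguerrePolya (partialTheta a)}

/-! Suppose f is Laguerre–Pólya. Positive coefficients give f(t) ≥ a₀ for t ≥ 0, so f = a₀ e^{βz} ∏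
(1 + u_k z) e^{-u_k z} with u_k > 0 and ∑ u_k ≤ β. Newton's identities, Cauchy–Schwarz and q₂ ≤ q₃
then give q₂ ≥ 3 and a zero -t with x = a₁t/a₀ ≤ 3 (`exists_zero_of_laguerrePolya`).

Choose s² strictly between c and `qInfty`. The series of f(-t)/a₀ and of g_s(-sx) share their first
two terms. From the third term on, the excess of the moduli of the former over those of the latter
is nonnegative and strictly decreasing (`gap_nonneg_and_strictAnti`), so its alternating sum is
positive. Since f(-t) = 0, it follows that g_s(-sx) < 0 (`altTheta_neg_of_zero`).

One such negative value suffices for g_s to be Laguerre–Pólya when s² ≥ 3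
(`laguerrePolya_partialTheta`): x ↦ g_s(-x) alternates in sign at 0, sx, s⁴, s⁶, …, and a growth
estimate shows that g_s is the product over the zeros so found. Hence `qInfty` ≤ s², a
contradiction. -/

/-! ### Alternating sums of decreasing sequences -/

theorem alternating_sum_bounds (n : ℕ) : ∀ (d : ℕ → ℝ), Antitone d → (∀ i, 0 ≤ d i) →
    0 ≤ ∑ i ∈ Finset.range n, (-1 : ℝ) ^ i * d i ∧
      ∑ i ∈ Finset.range n, (-1 : ℝ) ^ i * d i ≤ d 0 := by
  induction n with
  | zero => intro d _ h0; simpa using h0 0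
  | succ n ih =>
    intro d hd h0
    obtain ⟨h1, h2⟩ := ih (fun i => d (i + 1)) (fun i j h => hd (by omega)) (fun i => h0 _)
    have e : ∑ i ∈ Finset.range (n + 1), (-1 : ℝ) ^ i * d i =
        d 0 - ∑ i ∈ Finset.range n, (-1 : ℝ) ^ i * d (i + 1) := by
      rw [Finset.sum_range_succ', ← neg_add_eq_sub, ← Finset.sum_neg_distrib]
      simp [pow_succ]
    have := hd (Nat.zero_le 1)
    simp only [zero_add] at h2
    rw [e]
    constructor <;> linarith

theorem alternating_sum_le (n : ℕ) (d : ℕ → ℝ) (hd : Antitone d) (h0 : ∀ i, 0 ≤ d i) :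
    ∑ i ∈ Finset.range (n + 2), (-1 : ℝ) ^ i * d i ≤ d 0 - d 1 + d 2 := by
  obtain ⟨-, h2⟩ := alternating_sum_bounds n (fun i => d (i + 2)) (fun i j h => hd (by omega))
    (fun i => h0 _)
  rw [Finset.sum_range_succ', Finset.sum_range_succ']
  simp only [pow_succ, pow_zero, zero_add] at h2 ⊢
  simp only [mul_neg, mul_one, neg_neg, neg_mul, one_mul] at h2 ⊢
  linarith

theorem le_alternating_tsum (d : ℕ → ℝ) (hd : Antitone d) (h0 : ∀ i, 0 ≤ d i)
    {s : ℝ} (hs : HasSum (fun i => (-1 : ℝ) ^ i * d i) s) : d 0 - d 1 ≤ s := by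
  refine ge_of_tendsto (hs.tendsto_sum_nat.comp (tendsto_add_atTop_nat 2))
    (Eventually.of_forall fun n => ?_)
  obtain ⟨h1, -⟩ := alternating_sum_bounds n (fun i => d (i + 2)) (fun i j h => hd (by omega))
    (fun i => h0 _)
  simp only [Function.comp]
  rw [Finset.sum_range_succ', Finset.sum_range_succ']
  simp only [pow_succ, pow_zero, zero_add] at h1 ⊢
  simp only [mul_neg, mul_one, neg_neg, neg_mul, one_mul] at h1 ⊢
  linarith

theorem alternating_tsum_le (d : ℕ → ℝ) (hd : Antitone d) (h0 : ∀ i, 0 ≤ d i)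
    {s : ℝ} (hs : HasSum (fun i => (-1 : ℝ) ^ i * d i) s) : s ≤ d 0 - d 1 + d 2 :=
  le_of_tendsto (hs.tendsto_sum_nat.comp (tendsto_add_atTop_nat 2))
    (Eventually.of_forall fun n => alternating_sum_le n d hd h0)

/-! ### Growth and sign changes of the partial theta function -/

/-- The Gaussian weight `a ^ (-m ^ 2)`. -/
noncomputable def gaussWeight (a : ℝ) (m : ℤ) : ℝ := (a ^ (m.natAbs ^ 2))⁻¹

theorem gaussWeight_pos {a : ℝ} (ha : 1 < a) (m : ℤ) : 0 < gaussWeight a m := by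
  unfold gaussWeight; positivity

theorem summable_gaussWeight {a : ℝ} (ha : 1 < a) : Summable (gaussWeight a) := by
  have h : Summable fun n : ℕ => (a ^ (n ^ 2))⁻¹ := by
    refine Summable.of_nonneg_of_le (fun n => by positivity) (fun n => ?_)
      (summable_geometric_of_lt_one (r := a⁻¹) (by positivity) (inv_lt_one_of_one_lt₀ ha))
    rw [inv_pow]
    gcongr
    · exact ha.le
    · nlinarith [Nat.zero_le n, sq_nonneg ((n : ℤ) - 1), Nat.le_self_pow (two_ne_zero) n]
  refine Summable.of_nat_of_neg ?_ ?_ <;> simpa [gaussWeight] using h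

/-- Completing the square, 2Nj - j² = N² - (j - N)²: at radius a^{2N} the terms form a Gaussian
centred at j = N. -/
theorem pow_mul_div_pow_sq {a : ℝ} (ha : 1 < a) (N j : ℕ) :
    (a ^ (2 * N)) ^ j / a ^ (j ^ 2) = a ^ (N ^ 2) * gaussWeight a ((j : ℤ) - N) := by
  have h0 : a ≠ 0 := by positivity
  unfold gaussWeight
  rw [← div_eq_mul_inv, div_eq_div_iff (by positivity) (by positivity), ← pow_mul, ← pow_add,
    ← pow_add]
  congr 1
  zify
  rw [sq_abs]
  ring

theorem summable_gaussWeight_shift {a : ℝ} (ha : 1 < a) (N : ℕ) :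
    Summable fun j : ℕ => gaussWeight a ((j : ℤ) - N) :=
  (summable_gaussWeight ha).comp_injective (i := fun j : ℕ => (j : ℤ) - N)
    (fun i j h => by simpa using h)

theorem tsum_gaussWeight_shift_le {a : ℝ} (ha : 1 < a) (N : ℕ) :
    ∑' j : ℕ, gaussWeight a ((j : ℤ) - N) ≤ ∑' m, gaussWeight a m :=
  tsum_comp_le_tsum_of_inj (i := fun j : ℕ => (j : ℤ) - N) (summable_gaussWeight ha)
    (fun m => (gaussWeight_pos ha m).le) (fun i j h => by simpa using h)

theorem norm_partialTheta_term_le {a : ℝ} (ha : 1 < a) (N j : ℕ) {z : ℂ}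
    (hz : ‖z‖ ≤ a ^ (2 * N)) :
    ‖z ^ j / (a : ℂ) ^ (j ^ 2)‖ ≤ a ^ (N ^ 2) * gaussWeight a ((j : ℤ) - N) := by
  rw [← pow_mul_div_pow_sq ha, norm_div, norm_pow, norm_pow, Complex.norm_real,
    Real.norm_of_nonneg (by linarith)]
  gcongr

theorem exists_norm_le_pow {a : ℝ} (ha : 1 < a) (r : ℝ) : ∃ N : ℕ, r < a ^ (2 * N) := by
  obtain ⟨N, hN⟩ := pow_unbounded_of_one_lt r (show 1 < a ^ 2 by nlinarith)
  exact ⟨N, by rwa [pow_mul]⟩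

theorem hasSum_partialTheta {a : ℝ} (ha : 1 < a) (z : ℂ) :
    HasSum (fun j : ℕ => z ^ j / (a : ℂ) ^ (j ^ 2)) (partialTheta a z) := by
  obtain ⟨N, hN⟩ := exists_norm_le_pow ha ‖z‖
  exact (Summable.of_norm_bounded ((summable_gaussWeight_shift ha N).mul_left _)
    fun j => norm_partialTheta_term_le ha N j hN.le).hasSum

theorem norm_partialTheta_le {a : ℝ} (ha : 1 < a) (N : ℕ) {z : ℂ} (hz : ‖z‖ ≤ a ^ (2 * N)) :
    ‖partialTheta a z‖ ≤ a ^ (N ^ 2) * ∑' m, gaussWeight a m := by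
  refine (tsum_of_norm_bounded ((summable_gaussWeight_shift ha N).mul_left _).hasSum
    fun j => norm_partialTheta_term_le ha N j hz).trans ?_
  rw [tsum_mul_left]
  gcongr
  exact tsum_gaussWeight_shift_le ha N

theorem differentiable_partialTheta {a : ℝ} (ha : 1 < a) : Differentiable ℂ (partialTheta a) := by
  intro z
  obtain ⟨N, hN⟩ := exists_norm_le_pow ha ‖z‖
  refine (Complex.differentiableOn_tsum_of_summable_norm
    ((summable_gaussWeight_shift ha N).mul_left (a ^ (N ^ 2)))
    (F := fun (j : ℕ) (z : ℂ) => z ^ j / (a : ℂ) ^ (j ^ 2)) (U := Metric.ball 0 (a ^ (2 * N)))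
    (fun j => by fun_prop) Metric.isOpen_ball (fun j w hw => ?_)).differentiableAt
    (Metric.isOpen_ball.mem_nhds (by simpa using hN))
  exact norm_partialTheta_term_le ha N j (by simpa using (Metric.mem_ball.1 hw).le)

theorem partialTheta_zero (a : ℝ) : partialTheta a 0 = 1 := by
  unfold partialTheta
  rw [tsum_eq_single 0]
  · simp
  · intro j hj; simp [hj]

/-- The real function `x ↦ g_a(-x)`. -/
noncomputable def altTheta (a x : ℝ) : ℝ := (partialTheta a (-(x : ℂ))).re

theorem hasSum_altTheta {a : ℝ} (ha : 1 < a) (x : ℝ) :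
    HasSum (fun j : ℕ => (-1) ^ j * (x ^ j / a ^ (j ^ 2))) (altTheta a x) := by
  have h := Complex.hasSum_re (hasSum_partialTheta ha (-(x : ℂ)))
  refine h.congr_fun fun j => ?_
  rw [neg_pow (x : ℂ), mul_div_assoc]
  norm_cast

theorem partialTheta_neg_ofReal {a : ℝ} (ha : 1 < a) (x : ℝ) :
    partialTheta a (-(x : ℂ)) = (altTheta a x : ℂ) := by
  refine (hasSum_partialTheta ha (-(x : ℂ))).unique ?_
  convert Complex.hasSum_ofReal.2 (hasSum_altTheta ha x) using 2 with j
  rw [neg_pow, mul_div_assoc]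
  norm_cast

theorem continuous_altTheta {a : ℝ} (ha : 1 < a) : Continuous (altTheta a) := by
  have := (differentiable_partialTheta ha).continuous
  unfold altTheta
  fun_prop

theorem theta_numeric_pos {a : ℝ} (ha : 1 < a) (h3 : 3 ≤ a ^ 2) :
    (a⁻¹ - (a ^ 4)⁻¹ + (a ^ 9)⁻¹) * 2 < 1 := by
  have h1 : (1.73 : ℝ) ≤ a := by nlinarith
  have h2 : a ^ 4 - 2 * a ^ 3 + 1.4 ≥ 0 := by
    -- In powers of b all coefficients are nonnegative; with 1.4 the constant one is barely so.
    obtain ⟨b, rfl⟩ : ∃ b, a = b + 1.73 := ⟨a - 1.73, by ring⟩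
    have hb : 0 ≤ b := by linarith
    ring_nf
    have := pow_nonneg hb 2
    have := pow_nonneg hb 3
    have := pow_nonneg hb 4
    linarith
  have h5 : (1.73 : ℝ) ^ 5 ≤ a ^ 5 := by gcongr
  have h6 : 2 < a ^ 5 * (a ^ 4 - 2 * a ^ 3 + 2) := by nlinarith
  have e : (a⁻¹ - (a ^ 4)⁻¹ + (a ^ 9)⁻¹) * 2 = (2 * a ^ 8 - 2 * a ^ 5 + 2) / a ^ 9 := by
    field_simp
  rw [e, div_lt_one (by positivity)]
  nlinarith

theorem antitone_inv_pow_sq {a : ℝ} (ha : 1 < a) (m : ℕ) :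
    Antitone fun i : ℕ => (a ^ ((i + m) ^ 2))⁻¹ := by
  intro i j h
  dsimp only
  gcongr
  exact ha.le

/-- The central term j = n has modulus a^{n²} and dominates: after division by a^{n²}, each
alternating tail is at most a⁻¹ - a⁻⁴ + a⁻⁹, which is below 1/2. For n = 1 the left tail is the
single term a⁻¹ and this bound fails. -/
theorem altTheta_pow_sign {a : ℝ} (ha : 1 < a) (h3 : 3 ≤ a ^ 2) {n : ℕ} (hn : 2 ≤ n) :
    0 < (-1) ^ n * altTheta a (a ^ (2 * n)) := by
  have h := hasSum_altTheta ha (a ^ (2 * n))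
  simp only [pow_mul_div_pow_sq ha] at h
  have hs := h.summable
  have key := hs.sum_add_tsum_nat_add n
  rw [h.tsum_eq] at key
  have h2 := (summable_nat_add_iff n).2 hs
  set B := ∑' j : ℕ, (-1 : ℝ) ^ (j + n) * (a ^ n ^ 2 * gaussWeight a (((j + n : ℕ) : ℤ) - n))
    with hB
  have hsgn : ((-1 : ℝ) ^ n) * (-1) ^ n = 1 := by rw [← mul_pow]; norm_num
  have hp : 0 < a ^ n ^ 2 := by positivity
  have hB1 : HasSum (fun j : ℕ => (-1 : ℝ) ^ j * (a ^ ((j + 0) ^ 2))⁻¹)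
      ((-1) ^ n * B / a ^ n ^ 2) := by
    have := (h2.hasSum.mul_left ((-1 : ℝ) ^ n)).div_const (a ^ n ^ 2)
    refine this.congr_fun fun j => ?_
    have e : gaussWeight a (((j + n : ℕ) : ℤ) - n) = (a ^ ((j + 0) ^ 2))⁻¹ := by
      simp [gaussWeight]
    rw [e, pow_add, eq_div_iff hp.ne']
    linear_combination -(-1) ^ j * (a ^ ((j + 0) ^ 2))⁻¹ * a ^ n ^ 2 * hsgn
  have hB3 : 1 - (a⁻¹ - (a ^ 4)⁻¹ + (a ^ 9)⁻¹) ≤ (-1) ^ n * B / a ^ n ^ 2 := by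
    have hB2 : HasSum (fun j : ℕ => (-1 : ℝ) ^ j * (a ^ ((j + 1) ^ 2))⁻¹)
        (1 - (-1) ^ n * B / a ^ n ^ 2) := by
      have := ((hasSum_nat_add_iff' 1).2 hB1).neg
      rw [Finset.sum_range_one, neg_sub] at this
      simp only [zero_add, pow_zero, ne_eq, OfNat.ofNat_ne_zero, not_false_eq_true, zero_pow,
        inv_one, mul_one] at this
      refine this.congr_fun fun j => ?_
      rw [pow_succ (-1 : ℝ)]
      simp
    have := alternating_tsum_le _ (antitone_inv_pow_sq ha 1) (fun i => by positivity) hB2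
    norm_num at this
    linarith
  set A := ∑ j ∈ Finset.range n, (-1 : ℝ) ^ j * (a ^ n ^ 2 * gaussWeight a ((j : ℤ) - n)) with hA
  have hA1 : (-1) ^ n * A / a ^ n ^ 2 =
      -∑ i ∈ Finset.range n, (-1 : ℝ) ^ i * (a ^ ((i + 1) ^ 2))⁻¹ := by
    rw [hA, ← Finset.sum_range_reflect, Finset.mul_sum, Finset.sum_div, ← Finset.sum_neg_distrib]
    refine Finset.sum_congr rfl fun i hi => ?_
    have hi' := Finset.mem_range.1 hi
    obtain ⟨k, rfl⟩ : ∃ k, n = i + 1 + k := ⟨n - (i + 1), by omega⟩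
    have e1 : i + 1 + k - 1 - i = k := by omega
    have e2 : gaussWeight a ((k : ℤ) - (i + 1 + k : ℕ)) = (a ^ ((i + 1) ^ 2))⁻¹ := by
      have : ((k : ℤ) - (i + 1 + k : ℕ)).natAbs = i + 1 := by omega
      rw [gaussWeight, this]
    rw [e1, e2, div_eq_iff hp.ne', pow_add, pow_add]
    have hk : ((-1 : ℝ) ^ k) * (-1) ^ k = 1 := by rw [← mul_pow]; norm_num
    linear_combination -(-1) ^ i * a ^ (i + 1 + k) ^ 2 * (a ^ (i + 1) ^ 2)⁻¹ * hk
  have hA2 := alternating_sum_le (n - 2) _ (antitone_inv_pow_sq ha 1) (fun i => by positivity)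
  rw [Nat.sub_add_cancel hn] at hA2
  norm_num at hA2
  have hnum := theta_numeric_pos ha h3
  have : 0 < (-1) ^ n * A / a ^ n ^ 2 + (-1) ^ n * B / a ^ n ^ 2 := by
    rw [hA1]; linarith
  rw [← add_div, ← mul_add, key] at this
  exact (div_pos_iff_of_pos_right hp).1 this

/-! ### Product representation of the partial theta function -/

theorem exists_entire_quotient {F : ℂ → ℂ} (hF : Differentiable ℂ F) {y : ℕ → ℝ}
    (hy : ∀ k, 0 < y k) (hinj : Function.Injective y) (hz : ∀ k, F (-(y k : ℂ)) = 0) (n : ℕ) :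
    ∃ H : ℂ → ℂ, Differentiable ℂ H ∧
      ∀ z, F z = (∏ k ∈ Finset.range n, (1 + z / (y k : ℂ))) * H z := by
  induction n with
  | zero => exact ⟨F, hF, by simp⟩
  | succ n ih =>
    obtain ⟨H, hH, hFH⟩ := ih
    have hy0 : ∀ k, (y k : ℂ) ≠ 0 := fun k => by exact_mod_cast (hy k).ne'
    have h0 : H (-(y n : ℂ)) = 0 := by
      have h1 := hFH (-(y n : ℂ))
      rw [hz n] at h1
      refine (mul_eq_zero.1 h1.symm).resolve_left (Finset.prod_ne_zero_iff.2 fun k hk h2 => ?_)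
      have h3 : (y k : ℂ) = y n := by
        field_simp [hy0 k] at h2
        linear_combination h2
      exact (Finset.mem_range.1 hk).ne (hinj (by exact_mod_cast h3))
    -- `dslope` divides by z + y n; the factor y n turns this into division by 1 + z / y n.
    refine ⟨fun z => y n * dslope H (-(y n : ℂ)) z, ?_, fun z => ?_⟩
    · have := (Complex.differentiableOn_dslope (f := H) (c := -(y n : ℂ)) Filter.univ_mem).2
        hH.differentiableOn
      exact (differentiableOn_univ.1 this).const_mul _
    · have h4 := sub_smul_dslope H (-(y n : ℂ)) z
      rw [h0, sub_zero, smul_eq_mul] at h4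
      rw [hFH z, Finset.prod_range_succ, ← h4]
      have := hy0 n
      field_simp
      ring

/-- Maximum modulus and the Schwarz lemma give |H_n(z) - 1| ≤ (M_n + 1)|z| / R_n, a Liouville
argument in which M_n may grow. -/
theorem tendsto_one_of_norm_le {H : ℕ → ℂ → ℂ} (hH : ∀ n, Differentiable ℂ (H n))
    (h1 : ∀ n, H n 0 = 1) {R M : ℕ → ℝ} (hR : Tendsto R atTop atTop)
    (hM : ∀ n z, ‖z‖ = R n → ‖H n z‖ ≤ M n) (hMR : Tendsto (fun n => (M n + 1) / R n) atTop (𝓝 0))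
    (z : ℂ) : Tendsto (fun n => H n z) atTop (𝓝 1) := by
  rw [tendsto_iff_dist_tendsto_zero]
  have h2 : Tendsto (fun n => (M n + 1) / R n * ‖z‖) atTop (𝓝 0) := by
    simpa using hMR.mul_const ‖z‖
  refine squeeze_zero' (Eventually.of_forall fun n => dist_nonneg) ?_ h2
  filter_upwards [hR.eventually_gt_atTop (max ‖z‖ 0)] with n hn
  have hzR : ‖z‖ < R n := (le_max_left _ _).trans_lt hn
  have hR0 : 0 < R n := (le_max_right _ _).trans_lt hn
  have hb : ∀ w ∈ Metric.ball (0 : ℂ) (R n), ‖H n w‖ ≤ M n := fun w hw => by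
    refine Complex.norm_le_of_forall_mem_frontier_norm_le Metric.isBounded_ball
      (hH n).diffContOnCl (fun v hv => hM n v ?_) (subset_closure hw)
    rw [frontier_ball _ hR0.ne'] at hv
    simpa using hv
  have hmaps : Set.MapsTo (H n) (Metric.ball 0 (R n)) (Metric.closedBall (H n 0) (M n + 1)) := by
    intro w hw
    rw [Metric.mem_closedBall, dist_eq_norm, h1]
    calc ‖H n w - 1‖ ≤ ‖H n w‖ + ‖(1 : ℂ)‖ := norm_sub_le _ _
      _ ≤ M n + 1 := by rw [norm_one]; linarith [hb w hw]
  have := Complex.dist_le_div_mul_dist_of_mapsTo_ball (hH n).differentiableOn hmaps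
    (show z ∈ Metric.ball 0 (R n) by simpa using hzR)
  rwa [h1, dist_zero_right] at this

/-- As ∑ 1/y_k converges, the convergence factors e^{z/x_k}, x_k = -y_k, multiply to e^{-βz} with β
= ∑ 1/y_k, which the linear exponent cancels. -/
theorem laguerrePolya_of_tendsto_prod {F : ℂ → ℂ} {y : ℕ → ℝ} (hy : ∀ k, 0 < y k)
    (hs : Summable fun k => (y k)⁻¹)
    (hF : ∀ z, Tendsto (fun n => ∏ k ∈ Finset.range n, (1 + z / (y k : ℂ))) atTop (𝓝 (F z))) :
    LaguerrePolya F := by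
  have hprod : ∀ z : ℂ, HasProd (fun k : ℕ => 1 + z / (y k : ℂ)) (F z) := fun z => by
    have hm : Multipliable fun k : ℕ => 1 + z / (y k : ℂ) := by
      refine multipliable_one_add_of_summable ?_
      have : (fun k => ‖z / (y k : ℂ)‖) = fun k => ‖z‖ * (y k)⁻¹ := by
        funext k
        rw [norm_div, Complex.norm_real, Real.norm_of_nonneg (hy k).le, div_eq_mul_inv]
      rw [this]
      exact hs.mul_left _
    have := hm.hasProd
    rwa [tendsto_nhds_unique this.tendsto_prod_nat (hF z)] at this
  set β : ℝ := ∑' k, (y k)⁻¹ with hβ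
  have hexp : ∀ z : ℂ, HasProd (fun k : ℕ => Complex.exp (z / ((-y k : ℝ) : ℂ)))
      (Complex.exp (-(z * β))) := fun z => by
    have h : HasSum (fun k : ℕ => z / ((-y k : ℝ) : ℂ)) (-(z * β)) := by
      refine ((Complex.hasSum_ofReal.2 hs.hasSum).mul_left z).neg.congr_fun fun k => ?_
      push_cast
      rw [div_neg, div_eq_mul_inv]
    exact h.cexp
  refine ⟨1, 0, β, 0, Set.univ, fun k => -y k, fun z => F z * Complex.exp (-(z * β)), le_rfl,
    fun k => neg_ne_zero.2 (hy k).ne', ?_, fun z => ?_, fun z => ?_⟩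
  · have h2 : Summable fun k => (y k)⁻¹ ^ 2 := by
      refine Summable.of_norm_bounded_eventually_nat hs ?_
      filter_upwards [hs.tendsto_atTop_zero.eventually_lt_const one_pos] with k hk
      have := inv_pos.2 (hy k)
      rw [Real.norm_of_nonneg (by positivity)]
      nlinarith
    refine (h2.comp_injective (Subtype.val_injective (p := (· ∈ (Set.univ : Set ℕ))))).congr
      fun k => ?_
    simp
  · have := (hprod z).mul (hexp z)
    rw [← (Equiv.Set.univ ℕ).hasProd_iff] at this
    refine this.congr_fun fun k => ?_
    simp only [Function.comp, Equiv.Set.univ_apply]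
    push_cast
    rw [div_neg, sub_neg_eq_add]
  · dsimp only
    rw [mul_comm (F z), ← mul_assoc]
    simp only [Complex.ofReal_one, pow_zero, mul_one, Complex.ofReal_zero, neg_zero, zero_mul,
      zero_add, one_mul]
    rw [← Complex.exp_add, mul_comm (β : ℂ), add_neg_cancel, Complex.exp_zero, one_mul]

theorem exists_zeros_of_alternating_signs {G : ℝ → ℝ} (hG : Continuous G) {p : ℕ → ℝ}
    (hp : StrictMono p) (hs : ∀ n, 0 < (-1) ^ n * G (p n)) :
    ∃ y : ℕ → ℝ, ∀ k, p k < y k ∧ y k < p (k + 1) ∧ G (y k) = 0 := by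
  have : ∀ k, ∃ y, p k < y ∧ y < p (k + 1) ∧ G y = 0 := fun k => by
    have hle := (hp k.lt_succ_self).le
    have h1 := hs k
    have h2 := hs (k + 1)
    have hc : ContinuousOn (fun x => (-1 : ℝ) ^ k * G x) (Set.Icc (p k) (p (k + 1))) := by fun_prop
    rw [pow_succ] at h2
    obtain ⟨y, hy, hy0⟩ := intermediate_value_Ioo' hle hc
      (show (0 : ℝ) ∈ Set.Ioo _ _ from ⟨by linarith, h1⟩)
    exact ⟨y, hy.1, hy.2, (mul_eq_zero.1 hy0).resolve_left (by positivity)⟩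
  choose y hy using this
  exact ⟨y, hy⟩

/-- Points at which `altTheta a` has alternating signs. -/
def signPoints (a x : ℝ) : ℕ → ℝ
  | 0 => 0
  | 1 => x
  | n + 2 => a ^ (2 * (n + 2))

theorem strictMono_signPoints {a x : ℝ} (ha : 1 < a) (hx : 0 < x) (hxa : x ≤ a ^ 3) :
    StrictMono (signPoints a x) := by
  refine strictMono_nat_of_lt_succ fun n => ?_
  match n with
  | 0 => exact hx
  | 1 => exact hxa.trans_lt (pow_lt_pow_right₀ ha (by norm_num))
  | n + 2 => exact pow_lt_pow_right₀ ha (by omega)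

/-- Dividing g_a by the first n factors leaves H_n. On |z| = a^{2(n+2)}, g_a is O(a^{(n+2)²}), while
the factors have product at least (4/5)^n a^{n²+3n-1}. So H_n is O((5/4)^n a^n), which is o(|z|) as
a > 5/4, and H_n → 1: no other zeros and no exponential factor remain. -/
theorem laguerrePolya_partialTheta {a x : ℝ} (ha : 1 < a) (h3 : 3 ≤ a ^ 2) (hx : 0 < x)
    (hxa : x ≤ a ^ 3) (hneg : altTheta a x < 0) : LaguerrePolya (partialTheta a) := by
  have ha0 : 0 < a := by linarith
  have hmono := strictMono_signPoints ha hx hxa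
  obtain ⟨y, hy⟩ := exists_zeros_of_alternating_signs (continuous_altTheta ha) hmono fun n => by
    match n with
    | 0 => simp [signPoints, altTheta, partialTheta_zero]
    | 1 => simpa [signPoints] using hneg
    | n + 2 => exact altTheta_pow_sign ha h3 (by omega)
  have hypos : ∀ k, 0 < y k := fun k => (hmono.monotone (Nat.zero_le k)).trans_lt (hy k).1
  have hinj : Function.Injective y :=
    (strictMono_nat_of_lt_succ fun k => (hy k).2.1.trans (hy (k + 1)).1).injective
  have hle : ∀ k, y k ≤ a ^ (2 * k + 3) := fun k => by
    match k with
    | 0 => exact (hy 0).2.1.le.trans hxa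
    | k + 1 => exact (hy (k + 1)).2.1.le.trans (pow_le_pow_right₀ ha.le (by omega))
  have hprod_le : ∀ n, ∏ k ∈ Finset.range n, y k ≤ a ^ (n * (n + 1) + 1) := fun n => by
    induction n with
    | zero => simpa using ha.le
    | succ n ih =>
      rw [Finset.prod_range_succ]
      match n with
      | 0 => simpa using hle 0
      | n + 1 =>
        calc _ ≤ a ^ ((n + 1) * (n + 1 + 1) + 1) * a ^ (2 * (n + 2)) :=
              mul_le_mul ih (hy (n + 1)).2.1.le (hypos _).le (by positivity)
          _ = _ := by rw [← pow_add]; congr 1; ring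
  have hsum : Summable fun k => (y k)⁻¹ := by
    refine Summable.of_norm_bounded_eventually_nat
      (summable_geometric_of_lt_one (r := a⁻¹) (by positivity) (inv_lt_one_of_one_lt₀ ha)) ?_
    filter_upwards [eventually_ge_atTop 2] with k hk
    obtain ⟨m, rfl⟩ := Nat.exists_eq_add_of_le' hk
    rw [Real.norm_of_nonneg (inv_pos.2 (hypos _)).le, inv_pow]
    gcongr
    exact (pow_le_pow_right₀ ha.le (by omega)).trans (hy (m + 2)).1.le
  have hzero : ∀ k, partialTheta a (-(y k : ℂ)) = 0 := fun k => by
    rw [partialTheta_neg_ofReal ha, (hy k).2.2, Complex.ofReal_zero]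
  choose H hH hfac using exists_entire_quotient (differentiable_partialTheta ha) hypos hinj hzero
  set K := ∑' m, gaussWeight a m with hK
  have hK0 : 0 ≤ K := tsum_nonneg fun m => (gaussWeight_pos ha m).le
  have hH0 : ∀ n, H n 0 = 1 := fun n => by simpa [partialTheta_zero] using (hfac n 0).symm
  have hinv : a⁻¹ ^ 3 ≤ 1 / 5 := by
    have h17 : (1.73 : ℝ) ≤ a := by nlinarith
    rw [inv_pow, inv_eq_one_div]
    exact one_div_le_one_div_of_le (by norm_num)
      (le_trans (by norm_num) (pow_le_pow_left₀ (by norm_num) h17 3))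
  have hbound : ∀ n z, ‖z‖ = a ^ (2 * (n + 2)) → ‖H n z‖ ≤ K * (5 / 4) ^ n * a ^ (n + 5) := by
    intro n z hz
    -- Since |z| / y_k ≥ a³ ≥ 5, subtracting 1 costs at most a fifth.
    have hfactor : ∀ k ∈ Finset.range n, 4 / 5 * (a ^ (2 * (n + 2)) / y k) ≤ ‖1 + z / (y k : ℂ)‖ := by
      intro k hk
      have hkn := Finset.mem_range.1 hk
      have h1 : ‖z / (y k : ℂ)‖ = a ^ (2 * (n + 2)) / y k := by
        rw [norm_div, hz, Complex.norm_real, Real.norm_of_nonneg (hypos k).le]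
      have h2 : ‖z / (y k : ℂ)‖ - 1 ≤ ‖1 + z / (y k : ℂ)‖ := by
        have := norm_sub_norm_le (z / (y k : ℂ)) (-1)
        rwa [norm_neg, norm_one, sub_neg_eq_add, add_comm (z / (y k : ℂ))] at this
      have h5 : 5 ≤ a ^ (2 * (n + 2)) / y k := by
        rw [le_div_iff₀ (hypos k)]
        have h3' : 5 ≤ a ^ 3 := by
          rw [inv_pow, inv_le_comm₀ (by positivity) (by norm_num)] at hinv
          linarith
        calc 5 * y k ≤ a ^ 3 * a ^ (2 * k + 3) :=
              mul_le_mul h3' (hle k) (hypos k).le (by positivity)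
          _ = a ^ (3 + (2 * k + 3)) := (pow_add _ _ _).symm
          _ ≤ _ := pow_le_pow_right₀ ha.le (by omega)
      linarith
    have hP : (4 / 5) ^ n * ((a ^ (2 * (n + 2))) ^ n / a ^ (n * (n + 1) + 1)) ≤
        ‖∏ k ∈ Finset.range n, (1 + z / (y k : ℂ))‖ := by
      rw [norm_prod]
      refine le_trans ?_ (Finset.prod_le_prod (fun k _ => ?_) hfactor)
      · rw [Finset.prod_mul_distrib, Finset.prod_const, Finset.card_range,
          Finset.prod_div_distrib, Finset.prod_const, Finset.card_range]
        gcongr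
        · exact Finset.prod_pos fun k _ => hypos k
        · exact hprod_le n
      · have := hypos k
        positivity
    have hF := norm_partialTheta_le ha (n + 2) hz.le
    rw [hfac n z, norm_mul] at hF
    have h6 := (mul_le_mul_of_nonneg_right hP (norm_nonneg (H n z))).trans hF
    have h7 : K * (5 / 4) ^ n * a ^ (n + 5) *
        ((4 / 5) ^ n * ((a ^ (2 * (n + 2))) ^ n / a ^ (n * (n + 1) + 1))) =
        a ^ (n + 2) ^ 2 * K := by
      have e : (5 / 4 : ℝ) ^ n * (4 / 5) ^ n = 1 := by rw [← mul_pow]; norm_num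
      have e2 : a ^ (n + 5) * ((a ^ (2 * (n + 2))) ^ n / a ^ (n * (n + 1) + 1)) =
          a ^ (n + 2) ^ 2 := by
        rw [← mul_div_assoc, div_eq_iff (by positivity), ← pow_mul, ← pow_add, ← pow_add]
        congr 1
        ring
      rw [← e2]
      linear_combination K * (a ^ (n + 5) * ((a ^ (2 * (n + 2))) ^ n / a ^ (n * (n + 1) + 1))) * e
    rw [← h7, mul_comm _ ‖H n z‖] at h6
    exact le_of_mul_le_mul_right h6 (by positivity)
  have hR : Tendsto (fun n : ℕ => a ^ (2 * (n + 2))) atTop atTop :=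
    (tendsto_pow_atTop_atTop_of_one_lt ha).comp
      (tendsto_atTop_mono (fun n => by simp only [id]; omega) tendsto_id)
  have hMR : Tendsto (fun n : ℕ => (K * (5 / 4) ^ n * a ^ (n + 5) + 1) / a ^ (2 * (n + 2))) atTop
      (𝓝 0) := by
    have h54 : 5 / 4 / a < 1 := by
      rw [div_lt_one ha0]; nlinarith
    have h1 := (tendsto_pow_atTop_nhds_zero_of_lt_one (by positivity) h54).const_mul (K * a)
    have h2 := h1.add hR.inv_tendsto_atTop
    rw [mul_zero, add_zero] at h2
    refine h2.congr fun n => ?_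
    simp only [Pi.inv_apply]
    rw [add_div, one_div]
    congr 1
    rw [div_pow, eq_div_iff (by positivity)]
    field_simp
    ring
  have hlim := tendsto_one_of_norm_le hH hH0 hR hbound hMR
  refine laguerrePolya_of_tendsto_prod hypos hsum fun z => ?_
  have h1 := (tendsto_const_nhds (x := partialTheta a z)).div (hlim z) one_ne_zero
  rw [div_one] at h1
  refine h1.congr' ?_
  filter_upwards [(hlim z).eventually_ne one_ne_zero] with n hn
  rw [Pi.div_apply, hfac n z, mul_div_cancel_right₀ _ hn]

/-! ### Canonical products with positive Taylor coefficients -/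

theorem log_one_add_le_cubic {s : ℝ} (hs : 0 ≤ s) :
    Real.log (1 + s) ≤ s - s ^ 2 / 2 + s ^ 3 / 3 := by
  have hd : ∀ x ∈ Set.Ici (0 : ℝ), HasDerivAt
      (fun s : ℝ => s - s ^ 2 / 2 + s ^ 3 / 3 - Real.log (1 + s)) (x ^ 3 / (1 + x)) x := by
    intro x hx
    have hx' : 1 + x ≠ 0 := by linarith [Set.mem_Ici.1 hx]
    have h1 := ((hasDerivAt_id x).const_add 1).log hx'
    have h2 := (((hasDerivAt_id x).sub ((hasDerivAt_pow 2 x).div_const 2)).add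
      ((hasDerivAt_pow 3 x).div_const 3)).sub h1
    refine h2.congr_deriv ?_
    simp only [id]
    push_cast
    field_simp
    ring
  have hm : MonotoneOn (fun s : ℝ => s - s ^ 2 / 2 + s ^ 3 / 3 - Real.log (1 + s)) (Set.Ici 0) :=
    monotoneOn_of_deriv_nonneg (convex_Ici 0)
      (fun x hx => (hd x hx).continuousAt.continuousWithinAt)
      (fun x hx => (hd x (interior_subset hx)).differentiableAt.differentiableWithinAt)
      (fun x hx => by
        have h0 : 0 ≤ x := interior_subset hx
        rw [(hd x (interior_subset hx)).deriv]
        positivity)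
  have := hm (Set.mem_Ici.2 le_rfl) (Set.mem_Ici.2 hs) hs
  norm_num at this
  linarith

theorem quartic_le_log_one_add {s : ℝ} (hs : 0 ≤ s) :
    s - s ^ 2 / 2 + s ^ 3 / 3 - s ^ 4 / 4 ≤ Real.log (1 + s) := by
  have hd : ∀ x ∈ Set.Ici (0 : ℝ), HasDerivAt
      (fun s : ℝ => Real.log (1 + s) - (s - s ^ 2 / 2 + s ^ 3 / 3 - s ^ 4 / 4))
      (x ^ 4 / (1 + x)) x := by
    intro x hx
    have hx' : 1 + x ≠ 0 := by linarith [Set.mem_Ici.1 hx]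
    have h1 := ((hasDerivAt_id x).const_add 1).log hx'
    have h2 := h1.sub ((((hasDerivAt_id x).sub ((hasDerivAt_pow 2 x).div_const 2)).add
      ((hasDerivAt_pow 3 x).div_const 3)).sub ((hasDerivAt_pow 4 x).div_const 4))
    refine h2.congr_deriv ?_
    simp only [id]
    push_cast
    field_simp
    ring
  have hm : MonotoneOn (fun s : ℝ => Real.log (1 + s) - (s - s ^ 2 / 2 + s ^ 3 / 3 - s ^ 4 / 4))
      (Set.Ici 0) :=
    monotoneOn_of_deriv_nonneg (convex_Ici 0)
      (fun x hx => (hd x hx).continuousAt.continuousWithinAt)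
      (fun x hx => (hd x (interior_subset hx)).differentiableAt.differentiableWithinAt)
      (fun x hx => by
        have h0 : 0 ≤ x := interior_subset hx
        rw [(hd x (interior_subset hx)).deriv]
        positivity)
  have := hm (Set.mem_Ici.2 le_rfl) (Set.mem_Ici.2 hs) hs
  norm_num at this
  linarith

theorem one_add_mul_exp_neg_le_one (s : ℝ) : (1 + s) * Real.exp (-s) ≤ 1 := by
  have h := Real.add_one_le_exp s
  rw [Real.exp_neg, ← div_eq_mul_inv, div_le_one (Real.exp_pos s)]
  linarith

theorem HasProd.le_finset_prod_of_le_one {ι : Type*} {g : ι → ℝ} {Q : ℝ} (h : HasProd g Q)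
    (h0 : ∀ i, 0 ≤ g i) (h1 : ∀ i, g i ≤ 1) (F : Finset ι) : Q ≤ ∏ i ∈ F, g i := by
  classical
  refine le_of_tendsto h (a := Q) ?_
  filter_upwards [eventually_ge_atTop F] with G hG
  rw [← Finset.prod_sdiff hG]
  exact mul_le_of_le_one_left (Finset.prod_nonneg fun i _ => h0 i)
    (Finset.prod_le_one (fun i _ => h0 i) (fun i _ => h1 i))

/-- If ∑ u_k exceeded β, the right side would be a polynomial times a decaying exponential and tend
to 0. -/
theorem sum_le_of_one_le_exp_mul_prod {ι : Type*} {u : ι → ℝ} {β : ℝ} (F : Finset ι)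
    (hu : ∀ k, 0 ≤ u k)
    (h : ∀ t : ℝ, 0 ≤ t →
      1 ≤ Real.exp (β * t) * ∏ k ∈ F, (1 + u k * t) * Real.exp (-(u k * t))) :
    ∑ k ∈ F, u k ≤ β := by
  by_contra! hlt
  set U := ∑ k ∈ F, u k with hU
  have hU0 : 0 ≤ U := Finset.sum_nonneg fun k _ => hu k
  set δ := U - β with hδ
  have hδ0 : 0 < δ := by linarith
  obtain ⟨ε, hε0, hε1, hεU⟩ : ∃ ε : ℝ, 0 < ε ∧ ε ≤ 1 ∧ ε * U ≤ δ / 2 := by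
    refine ⟨min 1 (δ / (2 * (U + 1))), by positivity, min_le_left _ _, ?_⟩
    calc _ ≤ δ / (2 * (U + 1)) * (U + 1) := by
          gcongr
          · exact min_le_right _ _
          · linarith
      _ = δ / 2 := by field_simp
  set L := (F.card : ℝ) * -Real.log ε with hL
  have hL0 : 0 ≤ L := mul_nonneg (by positivity) (neg_nonneg.2 (Real.log_nonpos hε0.le hε1))
  have key : ∀ t : ℝ, 0 ≤ t → δ * t ≤ ε * U * t + L := by
    intro t ht
    have h1 := h t ht
    have hle : ∏ k ∈ F, (1 + u k * t) * Real.exp (-(u k * t)) ≤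
        ∏ k ∈ F, Real.exp (ε * (u k * t) - Real.log ε - u k * t) := by
      refine Finset.prod_le_prod (fun k _ => ?_) fun k _ => ?_
      · have := hu k
        positivity
      · have hs : 0 ≤ u k * t := mul_nonneg (hu k) ht
        -- Logarithmic growth in linear form: log(1 + s) ≤ εs - log ε for ε ≤ 1.
        have h3 := Real.log_le_sub_one_of_pos (show 0 < ε * (1 + u k * t) by positivity)
        rw [Real.log_mul hε0.ne' (by positivity)] at h3
        rw [sub_eq_add_neg _ (u k * t), Real.exp_add]
        refine mul_le_mul_of_nonneg_right ?_ (Real.exp_pos _).le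
        rw [← Real.log_le_iff_le_exp (by positivity)]
        linarith
    rw [← Real.exp_sum] at hle
    have h4 := h1.trans (mul_le_mul_of_nonneg_left hle (Real.exp_pos _).le)
    rw [← Real.exp_add, Real.one_le_exp_iff] at h4
    have h5 : ∑ k ∈ F, (ε * (u k * t) - Real.log ε - u k * t) = ε * U * t + L - U * t := by
      rw [Finset.sum_sub_distrib, Finset.sum_sub_distrib, ← Finset.mul_sum, ← Finset.sum_mul,
        Finset.sum_const, nsmul_eq_mul, hL]
      ring
    rw [h5] at h4
    rw [hδ]
    linarith
  have h6 := key (2 * L / δ + 1) (by positivity)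
  have h7 : δ * (2 * L / δ + 1) = 2 * L + δ := by field_simp
  have h8 : ε * U * (2 * L / δ + 1) ≤ δ / 2 * (2 * L / δ + 1) := by gcongr
  have h9 : δ / 2 * (2 * L / δ + 1) = L + δ / 2 := by field_simp
  linarith

/-- The structure of a Laguerre–Pólya function with positive Taylor coefficients `a`. -/
theorem exists_canonical_product_of_laguerrePolya {a : ℕ → ℝ} (ha : ∀ k, 0 < a k) {f : ℂ → ℂ}
    (hf : ∀ z : ℂ, HasSum (fun k : ℕ => (a k : ℂ) * z ^ k) (f z)) (hLP : LaguerrePolya f) :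
    ∃ (S : Set ℕ) (u : S → ℝ) (β : ℝ) (Q : ℝ → ℝ), (∀ k, 0 < u k) ∧ Summable u ∧ ∑' k, u k ≤ β ∧
      (∀ k, f (-((u k)⁻¹ : ℝ)) = 0) ∧
      (∀ t, 0 ≤ t → HasProd (fun k => (1 + u k * t) * Real.exp (-(u k * t))) (Q t)) ∧
      ∀ t, 0 ≤ t → HasSum (fun k => a k * t ^ k) (a 0 * Real.exp (β * t) * Q t) := by
  obtain ⟨C, α, β, n, S, x, P, hα, hx, -, hP, hfP⟩ := hLP
  have hf0 : f 0 = a 0 := by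
    refine (hf 0).unique ?_
    convert hasSum_single (f := fun k : ℕ => (a k : ℂ) * 0 ^ k) 0 (fun k hk => by simp [hk]) using 1
    simp
  have ha0 := ha 0
  have hn : n = 0 := by
    by_contra hn
    have := hfP 0
    rw [hf0, zero_pow hn] at this
    simp only [mul_zero, zero_mul, Complex.ofReal_eq_zero] at this
    exact ha0.ne' this
  subst hn
  have hP0 : P 0 = 1 := (hP 0).unique (by simp)
  have hC : C = a 0 := by
    have := hfP 0
    rw [hf0, hP0] at this
    simp at this
    exact this.symm
  subst hC
  -- The norm equals f(t) for t ≥ 0 and passes through the infinite product.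
  set A : ℝ → ℝ := fun t => ‖f t‖ with hA
  have hAsum : ∀ t : ℝ, 0 ≤ t → HasSum (fun k => a k * t ^ k) (A t) := by
    intro t ht
    have h1 : HasSum (fun k => a k * t ^ k) (f t).re :=
      (Complex.hasSum_re (hf t)).congr_fun fun k => by norm_cast
    have h2 : f t = ((f t).re : ℂ) :=
      (hf t).unique ((Complex.hasSum_ofReal.2 h1).congr_fun fun k => by norm_cast)
    have h3 : 0 ≤ (f t).re := h1.nonneg fun k => mul_nonneg (ha k).le (pow_nonneg ht k)
    rw [hA]
    dsimp only
    rw [h2, Complex.norm_real, Real.norm_of_nonneg h3]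
    exact h1
  -- This bound makes all zeros negative; as each canonical factor is at most 1 on t ≥ 0, it also
  -- forces α = 0 and ∑ u_k ≤ β.
  have hAle : ∀ t : ℝ, 0 ≤ t → a 0 ≤ A t := fun t ht => by
    simpa using le_hasSum (hAsum t ht) 0 fun k _ => mul_nonneg (ha k).le (pow_nonneg ht k)
  have hAeq : ∀ t : ℝ, A t = a 0 * Real.exp (-α * t ^ 2 + β * t) * ‖P t‖ := fun t => by
    simp only [hA]
    rw [hfP t, norm_mul, norm_mul, pow_zero, mul_one, Complex.norm_real,
      Real.norm_of_nonneg ha0.le, Complex.norm_exp]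
    norm_cast
  have hzero : ∀ k, f (x k) = 0 := fun k => by
    have : P (x k) = 0 := by
      refine (hP (x k)).unique (hasProd_zero_of_exists_eq_zero ⟨k, ?_⟩)
      rw [div_self (by exact_mod_cast hx k)]
      simp
    rw [hfP, this, mul_zero]
  have hxneg : ∀ k, x k < 0 := fun k => by
    by_contra! h
    have := hAle (x k) h
    simp only [hA] at this
    rw [hzero k, norm_zero] at this
    linarith
  have hupos : ∀ k, 0 < -(x k)⁻¹ := fun k => neg_pos.2 (inv_lt_zero.2 (hxneg k))
  have hQ : ∀ t : ℝ, 0 ≤ t →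
      HasProd (fun k => (1 + -(x k)⁻¹ * t) * Real.exp (-(-(x k)⁻¹ * t))) ‖P t‖ := by
    intro t ht
    refine ((hP t).norm).congr_fun fun k => ?_
    have h1 : (1 - (t : ℂ) / (x k : ℂ)) * Complex.exp (t / (x k : ℂ)) =
        (((1 + -(x k)⁻¹ * t) * Real.exp (-(-(x k)⁻¹ * t)) : ℝ) : ℂ) := by
      push_cast
      congr 2 <;> ring
    have := hupos k
    rw [h1, Complex.norm_real, Real.norm_of_nonneg (by positivity)]
  have hle : ∀ (F : Finset S) (t : ℝ), 0 ≤ t → 1 ≤ Real.exp (-α * t ^ 2 + β * t) *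
      ∏ k ∈ F, (1 + -(x k)⁻¹ * t) * Real.exp (-(-(x k)⁻¹ * t)) := by
    intro F t ht
    have h1 := hAle t ht
    rw [hAeq t, mul_assoc, le_mul_iff_one_le_right ha0] at h1
    refine h1.trans (mul_le_mul_of_nonneg_left ?_ (Real.exp_pos _).le)
    refine (hQ t ht).le_finset_prod_of_le_one (fun k => ?_) (fun k => ?_) F
    · have := hupos k
      positivity
    · exact one_add_mul_exp_neg_le_one _
  have hα0 : α = 0 := by
    by_contra hne
    have hα' : 0 < α := lt_of_le_of_ne hα (Ne.symm hne)
    have h1 := hle ∅ ((|β| + 1) / α) (by positivity)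
    rw [Finset.prod_empty, mul_one, Real.one_le_exp_iff] at h1
    have h2 : -α * ((|β| + 1) / α) ^ 2 + β * ((|β| + 1) / α) =
        ((|β| + 1) / α) * (β - |β| - 1) := by field_simp; ring
    rw [h2] at h1
    have h3 : 0 < (|β| + 1) / α := by positivity
    have h4 := le_abs_self β
    nlinarith
  subst hα0
  simp only [neg_zero, zero_mul, zero_add] at hle hAeq
  have hsum : ∀ F : Finset S, ∑ k ∈ F, -(x k)⁻¹ ≤ β := fun F =>
    sum_le_of_one_le_exp_mul_prod F (fun k => (hupos k).le) (hle F)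
  refine ⟨S, fun k => -(x k)⁻¹, β, fun t => ‖P t‖, hupos,
    summable_of_sum_le (fun k => (hupos k).le) hsum,
    Real.tsum_le_of_sum_le (fun k => (hupos k).le) hsum, fun k => ?_, hQ, fun t ht => ?_⟩
  · rw [inv_neg, inv_inv, Complex.ofReal_neg, neg_neg]
    exact hzero k
  · rw [← hAeq t]
    exact hAsum t ht

theorem exp_power_sums_bounds {ι : Type*} {u : ι → ℝ} (hu : ∀ k, 0 < u k) {p2 p3 p4 : ℝ}
    (h2 : HasSum (fun k => u k ^ 2) p2) (h3 : HasSum (fun k => u k ^ 3) p3)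
    (h4 : HasSum (fun k => u k ^ 4) p4) {t Q : ℝ} (ht : 0 ≤ t)
    (hQ : HasProd (fun k => (1 + u k * t) * Real.exp (-(u k * t))) Q) :
    Real.exp (-p2 * t ^ 2 / 2 + p3 * t ^ 3 / 3 - p4 * t ^ 4 / 4) ≤ Q ∧
      Q ≤ Real.exp (-p2 * t ^ 2 / 2 + p3 * t ^ 3 / 3) := by
  have hs : ∀ k, 0 ≤ u k * t := fun k => mul_nonneg (hu k).le ht
  have s1 : HasSum (fun k => -(u k * t) ^ 2 / 2 + (u k * t) ^ 3 / 3)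
      (-p2 * t ^ 2 / 2 + p3 * t ^ 3 / 3) := by
    refine ((((h2.neg).mul_right (t ^ 2)).div_const 2).add
      ((h3.mul_right (t ^ 3)).div_const 3)).congr_fun fun k => ?_
    ring
  have s2 : HasSum (fun k => -(u k * t) ^ 2 / 2 + (u k * t) ^ 3 / 3 - (u k * t) ^ 4 / 4)
      (-p2 * t ^ 2 / 2 + p3 * t ^ 3 / 3 - p4 * t ^ 4 / 4) := by
    refine (s1.sub ((h4.mul_right (t ^ 4)).div_const 4)).congr_fun fun k => ?_
    ring
  have e : ∀ k, (1 + u k * t) * Real.exp (-(u k * t)) =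
      Real.exp (Real.log (1 + u k * t) - u k * t) := fun k => by
    have := hs k
    rw [sub_eq_add_neg, Real.exp_add, Real.exp_log (by positivity)]
  simp only [e] at hQ
  constructor
  · refine le_of_tendsto_of_tendsto' s2.rexp hQ fun F => ?_
    refine Finset.prod_le_prod (fun k _ => (Real.exp_pos _).le) fun k _ => ?_
    exact Real.exp_le_exp.2 (by linarith [quartic_le_log_one_add (hs k)])
  · refine le_of_tendsto_of_tendsto' hQ s1.rexp fun F => ?_
    refine Finset.prod_le_prod (fun k _ => (Real.exp_pos _).le) fun k _ => ?_
    exact Real.exp_le_exp.2 (by linarith [log_one_add_le_cubic (hs k)])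

/-! ### Taylor coefficients up to order three -/

open Asymptotics

theorem isBigO_pow_of_mul_isBigO {g : ℝ → ℝ} {n : ℕ}
    (h : (fun t => t * g t) =O[𝓝[>] 0] fun t => t ^ (n + 1)) :
    g =O[𝓝[>] 0] fun t => t ^ n := by
  obtain ⟨K, hK⟩ := h.bound
  refine IsBigO.of_bound K ?_
  filter_upwards [hK, self_mem_nhdsWithin] with t h1 h2
  have ht : 0 < t := h2
  rw [norm_mul, pow_succ, norm_mul, Real.norm_of_nonneg ht.le] at h1
  refine le_of_mul_le_mul_left ?_ ht
  linarith

theorem eq_zero_of_isBigO_pow {g : ℝ → ℝ} (hg : Continuous g) {n : ℕ}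
    (h : g =O[𝓝[>] 0] fun t => t ^ (n + 1)) : g 0 = 0 := by
  have h1 : Tendsto (fun t : ℝ => t ^ (n + 1)) (𝓝[>] 0) (𝓝 0) := by
    have : Tendsto (fun t : ℝ => t ^ (n + 1)) (𝓝 0) (𝓝 (0 ^ (n + 1))) :=
      (continuous_pow (n + 1)).tendsto 0
    rw [zero_pow n.succ_ne_zero] at this
    exact this.mono_left nhdsWithin_le_nhds
  exact tendsto_nhds_unique ((hg.tendsto 0).mono_left nhdsWithin_le_nhds) (h.trans_tendsto h1)

theorem cubic_coeff_eq_zero {c0 c1 c2 c3 : ℝ}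
    (h : (fun t => c0 + c1 * t + c2 * t ^ 2 + c3 * t ^ 3) =O[𝓝[>] (0 : ℝ)] fun t => t ^ 4) :
    c1 = 0 ∧ c2 = 0 ∧ c3 = 0 := by
  have h0 : c0 = 0 := by simpa using eq_zero_of_isBigO_pow (by fun_prop) h
  subst h0
  have h' := isBigO_pow_of_mul_isBigO (g := fun t => c1 + c2 * t + c3 * t ^ 2) (n := 3)
    (h.congr_left fun t => by ring)
  have h1 : c1 = 0 := by simpa using eq_zero_of_isBigO_pow (by fun_prop) h'
  subst h1
  have h'' := isBigO_pow_of_mul_isBigO (g := fun t => c2 + c3 * t) (n := 2)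
    (h'.congr_left fun t => by ring)
  have h2 : c2 = 0 := by simpa using eq_zero_of_isBigO_pow (by fun_prop) h''
  subst h2
  have h''' := isBigO_pow_of_mul_isBigO (g := fun t => c3) (n := 1)
    (h''.congr_left fun t => by ring)
  exact ⟨rfl, rfl, by simpa using eq_zero_of_isBigO_pow (by fun_prop) h'''⟩

theorem isBigO_of_continuous_mul {g : ℝ → ℝ} (hg : Continuous g) (n : ℕ) :
    (fun t => g t * t ^ n) =O[𝓝[>] 0] fun t => t ^ n := by
  have h1 : g =O[𝓝[>] 0] fun _ => (1 : ℝ) :=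
    ((hg.tendsto 0).mono_left nhdsWithin_le_nhds).isBigO_one ℝ
  simpa using h1.mul (isBigO_refl (fun t : ℝ => t ^ n) (𝓝[>] 0))

theorem powerSeries_sub_cubic_isBigO {a : ℕ → ℝ} (ha : ∀ k, 0 < a k) {F : ℝ → ℝ}
    (hF : ∀ t, 0 ≤ t → HasSum (fun k => a k * t ^ k) (F t)) :
    (fun t => F t - (a 0 + a 1 * t + a 2 * t ^ 2 + a 3 * t ^ 3)) =O[𝓝[>] 0] fun t => t ^ 4 := by
  refine IsBigO.of_bound (F 1) ?_
  filter_upwards [Ioo_mem_nhdsGT (show (0 : ℝ) < 1 by norm_num)] with t ht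
  have h4 := (hasSum_nat_add_iff' 4).2 (hF t ht.1.le)
  have h5 := ((hF 1 zero_le_one).summable.comp_injective (add_left_injective 4)).hasSum.mul_right
    (t ^ 4)
  simp only [Finset.sum_range_succ, Finset.sum_range_zero, zero_add, pow_zero, mul_one,
    pow_one] at h4
  have ht0 := ht.1.le
  have h6 := h4.nonneg fun k => mul_nonneg (ha _).le (pow_nonneg ht0 _)
  rw [Real.norm_of_nonneg h6, Real.norm_of_nonneg (by positivity)]
  refine (hasSum_le (fun k => ?_) h4 h5).trans ?_
  · simp only [Function.comp, one_pow, mul_one]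
    rw [pow_add]
    have := pow_le_one₀ ht0 ht.2.le (n := k)
    have h7 := ha (k + 4)
    have : t ^ k * t ^ 4 ≤ 1 * t ^ 4 := by gcongr
    nlinarith
  · gcongr
    rw [← (hF 1 zero_le_one).tsum_eq]
    exact tsum_comp_le_tsum_of_inj (hF 1 zero_le_one).summable
      (fun k => mul_nonneg (ha k).le (by positivity)) (add_left_injective 4)

/-- The two exponentials differ by O(t⁴), so F has their cubic Taylor polynomial. These are Newton's
identities with β in the place of the first power sum. -/
theorem taylor_coeffs_of_exp_bounds {a : ℕ → ℝ} (ha : ∀ k, 0 < a k) {F : ℝ → ℝ}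
    (hF : ∀ t, 0 ≤ t → HasSum (fun k => a k * t ^ k) (F t)) {β p2 p3 p4 : ℝ}
    (hb : ∀ t, 0 ≤ t →
      a 0 * Real.exp (β * t + -p2 * t ^ 2 / 2 + p3 * t ^ 3 / 3 - p4 * t ^ 4 / 4) ≤ F t ∧
        F t ≤ a 0 * Real.exp (β * t + -p2 * t ^ 2 / 2 + p3 * t ^ 3 / 3)) :
    a 1 = a 0 * β ∧ a 2 = a 0 * ((β ^ 2 - p2) / 2) ∧
      a 3 = a 0 * (β ^ 3 / 6 - β * p2 / 2 + p3 / 3) := by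
  set A : ℝ → ℝ := fun t => β * t + -p2 * t ^ 2 / 2 + p3 * t ^ 3 / 3 with hA
  have hAc : Continuous A := by fun_prop
  have hA1 : A =O[𝓝[>] 0] fun t => t := by
    have := isBigO_of_continuous_mul (g := fun t => β + -p2 * t / 2 + p3 * t ^ 2 / 3)
      (by fun_prop) 1
    simp only [pow_one] at this
    refine this.congr_left fun t => ?_
    simp only [hA]
    ring
  have hexp : (fun t => Real.exp (A t) - (1 + A t + A t ^ 2 / 2 + A t ^ 3 / 6)) =O[𝓝[>] 0]
      fun t => t ^ 4 := by
    refine IsBigO.trans ?_ (hA1.pow 4)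
    refine IsBigO.of_bound 1 ?_
    have hsmall : ∀ᶠ t in 𝓝[>] (0 : ℝ), |A t| < 1 := by
      have : Tendsto (fun t => |A t|) (𝓝[>] 0) (𝓝 |A 0|) :=
        (hAc.abs.tendsto 0).mono_left nhdsWithin_le_nhds
      refine this.eventually_lt_const ?_
      simp [hA]
    filter_upwards [hsmall] with t ht
    have := Real.exp_bound ht.le (n := 4) (by norm_num)
    norm_num [Finset.sum_range_succ, Nat.factorial] at this
    rw [Real.norm_eq_abs, Real.norm_eq_abs, abs_pow, one_mul]
    have h0 : 0 ≤ |A t| ^ 4 := by positivity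
    linarith
  have hupper : (fun t => F t - a 0 * Real.exp (A t)) =O[𝓝[>] 0] fun t => t ^ 4 := by
    refine IsBigO.trans ?_ (isBigO_of_continuous_mul
      (g := fun t => a 0 * Real.exp (A t) * (p4 / 4)) (by fun_prop) 4)
    refine IsBigO.of_bound 1 ?_
    filter_upwards [self_mem_nhdsWithin] with t ht
    obtain ⟨h1, h2⟩ := hb t (le_of_lt ht)
    rw [one_mul, Real.norm_eq_abs, Real.norm_eq_abs, abs_of_nonpos (by linarith)]
    refine le_trans ?_ (le_abs_self _)
    have h3 : Real.exp (A t) * (1 - p4 * t ^ 4 / 4) ≤ Real.exp (A t - p4 * t ^ 4 / 4) := by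
      rw [sub_eq_add_neg (A t), Real.exp_add (A t)]
      exact mul_le_mul_of_nonneg_left (by linarith [Real.add_one_le_exp (-(p4 * t ^ 4 / 4))])
        (Real.exp_pos _).le
    have h4 := mul_le_mul_of_nonneg_left h3 (ha 0).le
    simp only [hA] at h4 ⊢
    nlinarith
  have hpoly : (fun t => a 0 * (1 + A t + A t ^ 2 / 2 + A t ^ 3 / 6) -
      a 0 * (1 + β * t + (β ^ 2 - p2) / 2 * t ^ 2 + (β ^ 3 / 6 - β * p2 / 2 + p3 / 3) * t ^ 3))
      =O[𝓝[>] 0] fun t => t ^ 4 := by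
    set B : ℝ → ℝ := fun t => -p2 / 2 + p3 * t / 3 with hB
    refine (isBigO_of_continuous_mul (g := fun t => a 0 * (β * p3 / 3 + B t ^ 2 / 2 +
      β ^ 2 * B t / 2 + β * B t ^ 2 * t / 2 + B t ^ 3 * t ^ 2 / 6)) ?_ 4).congr_left fun t => ?_
    · fun_prop
    · simp only [hA, hB]
      ring
  have hps := powerSeries_sub_cubic_isBigO ha hF
  have hfin := ((hupper.add (hexp.const_mul_left (a 0))).add hpoly).sub hps
  obtain ⟨h1, h2, h3⟩ := cubic_coeff_eq_zero (c0 := a 0 - a 0) (c1 := a 1 - a 0 * β)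
    (c2 := a 2 - a 0 * ((β ^ 2 - p2) / 2))
    (c3 := a 3 - a 0 * (β ^ 3 / 6 - β * p2 / 2 + p3 / 3)) (hfin.congr_left fun t => by ring)
  exact ⟨by linarith, by linarith, by linarith⟩

/-! ### Termwise comparison with the partial theta function -/

/-- By r ≤ L²r' it suffices that r(L² + L + 1) < L², which holds as r ≤ 1/3 and L > 1. With L = T/T'
and r, r' the successive ratios, this says that T - T' decreases. -/
theorem one_sub_lt_mul_one_sub {L R r r' : ℝ} (hL : 1 < L) (hRL : R ≤ L ^ 2) (hr' : 0 ≤ r')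
    (hr : r = R * r') (hr3 : r ≤ 1 / 3) : 1 - r' < L * (1 - r) := by
  have hL0 : 0 < L := by linarith
  have h1 : r ≤ L ^ 2 * r' := by rw [hr]; gcongr
  have h2 : r * (L ^ 2 + L + 1) < L ^ 2 := by nlinarith
  have h3 : L ^ 2 * (1 - r') < L ^ 2 * (L * (1 - r)) := by
    nlinarith [mul_lt_mul_of_pos_left h2 (sub_pos.2 hL)]
  exact lt_of_mul_lt_mul_left h3 (by positivity)

theorem gap_nonneg_and_strictAnti {T T' r r' q : ℕ → ℝ} {c : ℝ} (hT0 : T 0 = 1) (hT0' : T' 0 = 1)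
    (hT : ∀ k, T (k + 1) = T k * r k) (hT' : ∀ k, T' (k + 1) = T' k * r' k)
    (hr0 : r 0 = r' 0) (hrpos : ∀ k, 0 < r' k) (hr3 : r 0 ≤ 3)
    (hr : ∀ k, r (k + 1) * q k = r k) (hr' : ∀ k, r' (k + 1) * c = r' k)
    (hq : Monotone q) (hq3 : ∀ k, 3 ≤ q k) (hqc : ∀ k, q k < c) :
    ∀ k, T' (k + 2) ≤ T (k + 2) ∧ T (k + 3) - T' (k + 3) < T (k + 2) - T' (k + 2) := by
  have hqpos : ∀ k, 0 < q k := fun k => by linarith [hq3 k]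
  set M : ℕ → ℝ := fun k => c / q k with hMdef
  have hM : ∀ k, 1 < M k := fun k => (one_lt_div (hqpos k)).2 (hqc k)
  have hManti : ∀ k, M (k + 1) ≤ M k := fun k =>
    div_le_div_of_nonneg_left (by linarith [hqc 0, hqpos 0]) (hqpos k) (hq k.le_succ)
  have hTpos' : ∀ k, 0 < T' k := fun k => by
    induction k with
    | zero => rw [hT0']; exact one_pos
    | succ k ih => rw [hT']; exact mul_pos ih (hrpos k)
  set R : ℕ → ℝ := fun k => r k / r' k with hRdef
  set L : ℕ → ℝ := fun k => T k / T' k with hLdef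
  have hrR : ∀ k, r k = R k * r' k := fun k => (div_mul_cancel₀ _ (hrpos k).ne').symm
  have hTL : ∀ k, T k = L k * T' k := fun k => (div_mul_cancel₀ _ (hTpos' k).ne').symm
  have hRs : ∀ k, R (k + 1) = R k * M k := fun k => by
    have h1 := hqpos k
    have h2 := hrpos k
    have h3 := hrpos (k + 1)
    simp only [hRdef, hMdef]
    rw [← hr k, ← hr' k]
    have : c ≠ 0 := by linarith [hqc k]
    field_simp
  have hLs : ∀ k, L (k + 1) = L k * R k := fun k => by
    simp only [hRdef, hLdef]
    rw [hT, hT', mul_div_mul_comm]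
  have hR1 : ∀ k, 1 ≤ R k := fun k => by
    induction k with
    | zero => simp only [hRdef]; rw [hr0, div_self (hrpos 0).ne']
    | succ k ih => rw [hRs]; exact one_le_mul_of_one_le_of_one_le ih (hM k).le
  have hL1 : ∀ k, 1 ≤ L k := fun k => by
    induction k with
    | zero => simp only [hLdef]; rw [hT0, hT0', div_self one_ne_zero]
    | succ k ih => rw [hLs]; exact one_le_mul_of_one_le_of_one_le ih (hR1 k)
  have hRM : ∀ k, M k ≤ R (k + 1) := fun k => by
    rw [hRs]
    exact le_mul_of_one_le_left (by linarith [hM k]) (hR1 k)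
  have hLR : ∀ k, R (k + 1) ≤ L (k + 2) := fun k => by
    rw [hLs (k + 1)]
    exact le_mul_of_one_le_left (by linarith [hR1 (k + 1)]) (hL1 (k + 1))
  have hrpos0 : ∀ k, 0 < r k := fun k => by
    rw [hrR]; exact mul_pos (by linarith [hR1 k]) (hrpos k)
  have hr2 : ∀ k, r (k + 2) ≤ 1 / 3 := fun k => by
    induction k with
    | zero =>
      have h1 := hr 0
      have h2 := hr 1
      have := hrpos0 1
      have := hrpos0 2
      nlinarith [hq3 0, hq3 1]
    | succ k ih =>
      have h1 := hr (k + 2)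
      have := hrpos0 (k + 3)
      have e : k + 1 + 2 = k + 2 + 1 := by omega
      rw [e]
      nlinarith [hq3 (k + 2)]
  intro k
  have hTk := hTpos' (k + 2)
  constructor
  · rw [hTL]
    exact le_mul_of_one_le_left hTk.le (hL1 _)
  · have hL : 1 < L (k + 2) := (hM k).trans_le ((hRM k).trans (hLR k))
    -- R_{k+2} = R_{k+1} M_{k+1}, and both factors are at most L_{k+2}; the second because M = c/q
    -- is nonincreasing, which is where monotonicity of q enters.
    have hRL : R (k + 2) ≤ L (k + 2) ^ 2 := by
      rw [hRs, sq]
      exact mul_le_mul (hLR k) ((hManti k).trans ((hRM k).trans (hLR k)))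
        (by linarith [hM (k + 1)]) (by linarith)
    have h1 := one_sub_lt_mul_one_sub hL hRL (hrpos (k + 2)).le (hrR (k + 2)) (hr2 k)
    have h2 := mul_lt_mul_of_pos_left h1 hTk
    rw [hT (k + 2), hT' (k + 2), hTL (k + 2)]
    linarith

/-! ### A zero close to the origin -/

/-- The first Newton-type consequence of real-rootedness for increasing second quotients. -/
theorem three_mul_le_sq {β e2 e3 p1 p2 p3 : ℝ} (hβ : 0 < β) (he2 : 0 < e2) (hp1 : p1 ≤ β)
    (hp2 : p2 = β ^ 2 - 2 * e2) (hp3 : p3 = 3 * e3 + β ^ 3 - 3 * β * e2) (hp2' : 0 ≤ p2)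
    (hcs : ∀ l : ℝ, 0 ≤ p3 - 2 * l * p2 + l ^ 2 * p1) (hq : β ^ 3 * e3 ≤ e2 ^ 3) :
    3 * e2 ≤ β ^ 2 := by
  have h1 : p2 ^ 2 ≤ β * p3 := by
    -- `hcs` stands for ∑ u(u - l)² ≥ 0; this l yields Cauchy–Schwarz with β in place of p1.
    have h2 := hcs (p2 / β)
    have h3 : (p2 / β) ^ 2 * p1 ≤ (p2 / β) ^ 2 * β := by gcongr
    have h4 : p3 - 2 * (p2 / β) * p2 + (p2 / β) ^ 2 * β = (β * p3 - p2 ^ 2) / β := by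
      field_simp
      ring
    have h5 : 0 ≤ (β * p3 - p2 ^ 2) / β := by rw [← h4]; linarith
    rw [le_div_iff₀ hβ, zero_mul] at h5
    linarith
  have h2 : 4 * e2 ^ 2 ≤ 3 * β * e3 + β ^ 2 * e2 := by
    rw [hp2, hp3] at h1
    nlinarith
  have h3 : 0 ≤ e2 * ((β ^ 2 - e2) * (β ^ 2 - 3 * e2)) := by
    nlinarith [mul_le_mul_of_nonneg_left h2 (sq_nonneg β)]
  have h4 := (mul_nonneg_iff_of_pos_left he2).1 h3
  have h5 := (mul_nonneg_iff_of_pos_left (show 0 < β ^ 2 - e2 by linarith)).1 h4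
  linarith

theorem summable_pow_of_summable {ι : Type*} {u : ι → ℝ} (hu : ∀ k, 0 < u k) (hs : Summable u)
    {B : ℝ} (hB : ∀ k, u k ≤ B) (n : ℕ) : Summable fun k => u k ^ (n + 1) := by
  refine Summable.of_nonneg_of_le (fun k => pow_nonneg (hu k).le _) (fun k => ?_)
    (hs.mul_left (B ^ n))
  rw [pow_succ]
  have := (hu k).le
  gcongr
  exact hB k

/-- A Laguerre–Pólya function with positive coefficients and nondecreasing second quotients has
its second quotients at least `3` and a zero in `[-3 a₀ / a₁, 0)`. -/
theorem exists_zero_of_laguerrePolya {a : ℕ → ℝ} (ha : ∀ k, 0 < a k) {f : ℂ → ℂ}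
    (hf : ∀ z : ℂ, HasSum (fun k : ℕ => (a k : ℂ) * z ^ k) (f z))
    (hq : secondQuotient a 2 ≤ secondQuotient a 3) (hLP : LaguerrePolya f) :
    3 ≤ secondQuotient a 2 ∧ ∃ t : ℝ, 0 < t ∧ a 1 / a 0 * t ≤ 3 ∧ f (-t : ℝ) = 0 := by
  obtain ⟨S, u, β, Q, hu, hs, hle, hzero, hQ, hF⟩ :=
    exists_canonical_product_of_laguerrePolya ha hf hLP
  have huβ : ∀ k, u k ≤ β := fun k => (hs.le_tsum k fun j _ => (hu j).le).trans hle
  have h2 := (summable_pow_of_summable hu hs huβ 1).hasSum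
  have h3 := (summable_pow_of_summable hu hs huβ 2).hasSum
  have h4 := (summable_pow_of_summable hu hs huβ 3).hasSum
  simp only [Nat.reduceAdd] at h2 h3 h4
  set p1 := ∑' k, u k with hp1
  set p2 := ∑' k, u k ^ 2 with hp2
  set p3 := ∑' k, u k ^ 3 with hp3
  set p4 := ∑' k, u k ^ 4 with hp4
  have ha0 := ha 0
  obtain ⟨e1, e2, e3⟩ := taylor_coeffs_of_exp_bounds ha hF (β := β) (p2 := p2) (p3 := p3)
    (p4 := p4) fun t ht => by
      obtain ⟨hb1, hb2⟩ := exp_power_sums_bounds hu h2 h3 h4 ht (hQ t ht)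
      have e : β * t + -p2 * t ^ 2 / 2 + p3 * t ^ 3 / 3 - p4 * t ^ 4 / 4 =
        β * t + (-p2 * t ^ 2 / 2 + p3 * t ^ 3 / 3 - p4 * t ^ 4 / 4) := by ring
      rw [e, add_assoc (β * t), Real.exp_add, Real.exp_add, ← mul_assoc, ← mul_assoc]
      exact ⟨by gcongr, by gcongr⟩
  set E2 := (β ^ 2 - p2) / 2 with hE2
  set E3 := β ^ 3 / 6 - β * p2 / 2 + p3 / 3 with hE3
  have hβ : 0 < β := (mul_pos_iff_of_pos_left ha0).1 (e1 ▸ ha 1)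
  have hE2pos : 0 < E2 := (mul_pos_iff_of_pos_left ha0).1 (e2 ▸ ha 2)
  have hE3pos : 0 < E3 := (mul_pos_iff_of_pos_left ha0).1 (e3 ▸ ha 3)
  have hq2 : secondQuotient a 2 = β ^ 2 / E2 := by
    simp only [secondQuotient, Nat.reduceSub, e1, e2]
    field_simp
  have hq3 : secondQuotient a 3 = E2 ^ 2 / (β * E3) := by
    simp only [secondQuotient, Nat.reduceSub, e1, e2, e3]
    field_simp
  have hcube : β ^ 3 * E3 ≤ E2 ^ 3 := by
    rw [hq2, hq3, div_le_div_iff₀ hE2pos (by positivity)] at hq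
    linarith
  have hcs : ∀ l : ℝ, 0 ≤ p3 - 2 * l * p2 + l ^ 2 * p1 := fun l => by
    refine ((h3.sub (h2.mul_left (2 * l))).add (hs.hasSum.mul_left (l ^ 2))).nonneg fun k => ?_
    have : u k ^ 3 - 2 * l * u k ^ 2 + l ^ 2 * u k = u k * (u k - l) ^ 2 := by ring
    rw [this]
    exact mul_nonneg (hu k).le (sq_nonneg _)
  have hp2nonneg : 0 ≤ p2 := h2.nonneg fun k => sq_nonneg _
  have hmain : 3 * E2 ≤ β ^ 2 := three_mul_le_sq hβ hE2pos hle (by rw [hE2]; ring)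
    (by rw [hE2, hE3]; ring) hp2nonneg hcs hcube
  refine ⟨by rwa [hq2, le_div_iff₀ hE2pos], ?_⟩
  -- Otherwise p2 < β p1 / 3 ≤ β²/3, whereas p2 = β² - 2 E2 ≥ β²/3.
  obtain ⟨k, hk⟩ : ∃ k, β ≤ 3 * u k := by
    by_contra! hlt
    have hp2pos : 0 < p2 := by nlinarith
    have hne : Nonempty S := by
      by_contra hemp
      rw [not_nonempty_iff] at hemp
      rw [hp2, tsum_empty] at hp2pos
      exact hp2pos.false
    obtain ⟨i⟩ := hne
    have hlt' : ∀ k, 3 * u k ^ 2 < β * u k := fun k => by nlinarith [hlt k, hu k]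
    have := hasSum_lt (fun k => (hlt' k).le) (hlt' i) (h2.mul_left 3) (hs.hasSum.mul_left β)
    nlinarith
  refine ⟨(u k)⁻¹, inv_pos.2 (hu k), ?_, by rw [Complex.ofReal_neg]; exact hzero k⟩
  rw [e1, mul_div_cancel_left₀ _ ha0.ne', ← div_eq_mul_inv, div_le_iff₀ (hu k)]
  exact hk

/-- The argument s·x is scaled so that both series begin 1 - x. The remaining alternating sum of
gaps is at least the first gap minus the second, hence positive, and it equals 0 - g_s(-sx). -/
theorem altTheta_neg_of_zero {a : ℕ → ℝ} (ha : ∀ k, 0 < a k) {f : ℂ → ℂ}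
    (hf : ∀ z : ℂ, HasSum (fun k : ℕ => (a k : ℂ) * z ^ k) (f z))
    (hmono : MonotoneOn (secondQuotient a) (Set.Ici 2)) (h3 : 3 ≤ secondQuotient a 2)
    {s : ℝ} (hs : 1 < s) (hlt : ∀ n, 2 ≤ n → secondQuotient a n < s ^ 2) {t : ℝ} (ht : 0 < t)
    (hx : a 1 / a 0 * t ≤ 3) (hzero : f (-t : ℝ) = 0) :
    altTheta s (s * (a 1 / a 0 * t)) < 0 := by
  have hs0 : 0 < s := by linarith
  have ha0 := ha 0
  set x := a 1 / a 0 * t with hxdef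
  have hx0 : 0 < x := mul_pos (div_pos (ha 1) ha0) ht
  have hgap := gap_nonneg_and_strictAnti (T := fun k => a k / a 0 * t ^ k)
    (T' := fun k => (s * x) ^ k / s ^ (k ^ 2)) (r := fun k => a (k + 1) / a k * t)
    (r' := fun k => x / (s ^ 2) ^ k) (q := fun k => secondQuotient a (k + 2)) (c := s ^ 2)
    (by simp [ha0.ne']) (by simp) (fun k => ?_) (fun k => ?_) (by simp [hxdef])
    (fun k => by positivity) hx (fun k => ?_) (fun k => ?_)
    (fun i j hij => hmono (by simp) (by simp) (by omega))
    (fun k => h3.trans (hmono (by simp) (by simp) (by omega))) (fun k => hlt _ (by omega))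
  rotate_left
  · have := ha k
    simp only [pow_succ]
    field_simp
  · have e : s ^ ((k + 1) ^ 2) = s ^ (k ^ 2) * (s ^ 2) ^ k * s := by
      rw [← pow_mul, ← pow_add, ← pow_succ]
      congr 1
      ring
    rw [e, pow_succ]
    field_simp
  · have h0 := ha k
    have h1 := ha (k + 1)
    have h2 := ha (k + 2)
    simp only [secondQuotient, Nat.add_sub_cancel, show k + 2 - 1 = k + 1 by omega,
      show k + 1 + 1 = k + 2 by omega]
    field_simp
  · simp only [pow_succ (s ^ 2)]
    field_simp
  have hsumT : HasSum (fun k => (-1 : ℝ) ^ k * (a k / a 0 * t ^ k)) 0 := by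
    have h1 := (Complex.hasSum_re (hf (-t : ℝ))).div_const (a 0)
    rw [hzero, Complex.zero_re, zero_div] at h1
    refine h1.congr_fun fun k => ?_
    rw [← Complex.ofReal_pow, ← Complex.ofReal_mul, Complex.ofReal_re, neg_pow t]
    ring
  have hdiff := hsumT.sub (hasSum_altTheta hs (s * x))
  have hdiff2 := (hasSum_nat_add_iff' 2).2 hdiff
  have hx1 : a 1 / a 0 * t = s * x / s := by rw [mul_div_cancel_left₀ _ hs0.ne']
  simp only [Finset.sum_range_succ, Finset.sum_range_zero, pow_zero, pow_one, one_pow, mul_one,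
    zero_add, div_self ha0.ne', ← hxdef, mul_div_cancel_left₀ _ hs0.ne', zero_pow two_ne_zero,
    div_one, sub_self, sub_zero, zero_sub] at hdiff2
  have := le_alternating_tsum
    (fun k => a (k + 2) / a 0 * t ^ (k + 2) - (s * x) ^ (k + 2) / s ^ ((k + 2) ^ 2))
    (antitone_nat_of_succ_le fun k => (hgap k).2.le) (fun k => sub_nonneg.2 (hgap k).1)
    (hdiff2.congr_fun fun k => by rw [pow_add (-1 : ℝ) k 2]; ring)
  have h0 := (hgap 0).2
  simp only [zero_add, Nat.reduceAdd] at this h0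
  linarith

/-! ### Conclusion -/

theorem theorem1 (a : ℕ → ℝ) (ha : ∀ k, 0 < a k)
    (f : ℂ → ℂ) (hf : ∀ z : ℂ, HasSum (fun k : ℕ => (a k : ℂ) * z ^ k) (f z))
    (hmono : MonotoneOn (secondQuotient a) (Set.Ici 2))
    (c : ℝ) (hlim : Tendsto (secondQuotient a) atTop (𝓝 c)) (hc : c < qInfty) :
    ¬ LaguerrePolya f := by
  intro hLP
  obtain ⟨h3, t, ht, hx, hzero⟩ :=
    exists_zero_of_laguerrePolya ha hf (hmono (by simp) (by simp) (by omega)) hLP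
  obtain ⟨q, hcq, hq⟩ := exists_between hc
  have hle : ∀ n, 2 ≤ n → secondQuotient a n ≤ c := fun n hn =>
    ge_of_tendsto hlim ((eventually_ge_atTop n).mono fun m hm =>
      hmono hn (hn.trans hm) hm)
  have hq3 : 3 < q := by linarith [hle 2 le_rfl]
  set s := √q with hs
  have hsq : s ^ 2 = q := Real.sq_sqrt (by linarith)
  have hs1 : 1 < s := Real.lt_sqrt_of_sq_lt (by linarith)
  have hneg := altTheta_neg_of_zero ha hf hmono h3 hs1
    (fun n hn => by rw [hsq]; linarith [hle n hn]) ht hx hzero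
  have hpos : 0 < a 1 / a 0 * t := mul_pos (div_pos (ha 1) (ha 0)) ht
  -- Here sx ≤ s³ because x ≤ 3 < s².
  have hmem := laguerrePolya_partialTheta hs1 (by rw [hsq]; exact hq3.le)
    (mul_pos (by linarith) hpos) (by nlinarith) hneg
  have hinf : qInfty ≤ q := by
    refine csInf_le ⟨1, ?_⟩ ⟨s, hs1, hsq.symm, hmem⟩
    rintro _ ⟨b, hb, rfl, -⟩
    nlinarith
  linarith
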